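/- **Setting.** Let $\Phi, F, G\in\mathbb Z[X,Y]$ have positive degree in $Y$, let $I\subseteq\mathbb R$ be an open interval, and let $\varphi$ be a real function that is differentiable on $I$ with $\varphi'(x)=\Phi(x,\varphi(x))$ for $x\in I$. Put $f(x)=F(x,\varphi(x))$ and $g(x)=G(x,\varphi(x))$, and assume that $f$ is not identically zero on $I$. Let $\widetilde F=\frac{\partial F}{\partial X}+\frac{\partial F}{\partial Y}\Phi$. **Subresultants.** Regard polynomials in $\mathbb Z[X,Y]$ as polynomials in $Y$ over $\mathbb Z[X]$. Let $P=\widetilde FG$, $p=\deg_Y P$, $q=\deg_Y F$ (one has $p>q$). For $0\le j\le q$, let $\mathrm{SRes}_j\in\mathbb Z[X][Y]$ be the $j$-th signed subresultant of $P$ and $F$, that is, the polynomial determinant of the $m=p+q-2j$ polynomials $$Y^{q-j-1}P,\ \dots,\ YP,\ P,\ F,\ YF,\ \dots,\ Y^{p-j-1}F$$ in this order: its coefficient of $Y^k$ ($0\le k\le j$) is the determinant of the $m\times m$ matrix whose rows contain the coefficients of these polynomials at $Y^{p+q-j-1},Y^{p+q-j-2},\dots,Y^{j+1}$ (the first $m-1$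 columns) and at $Y^k$ (the last column). Let $s_j\in\mathbb Z[X]$ be the coefficient of $Y^j$ in $\mathrm{SRes}_j$, and put $\mathrm{SRes}_{-1}=0$. Let $R_0=F$ and, for $i\ge0$, as long as $R_i\ne0$, let $n_{i+1}=\deg_Y R_i$ and $R_{i+1}=\mathrm{SRes}_{n_{i+1}-1}$. Let $N=\max\{i\ge0: R_i\ne0\}$. For $0\le i\le N$, let $\tau_i\in\mathbb Z[X]$ be the leading coefficient of $R_i$ in $Y$ and $F_i=R_i/R_N\in\mathbb Q(X)[Y]$; for $1\le i\le N+1$, let $\rho_i=s_{n_i}$. Let $\delta=p-q+1$ and $\epsilon=(-1)^{\delta(\delta+1)/2}$. Assume that $I$ contains no root of $\tau_0,\dots,\tau_N,\rho_1,\dots,\rho_{N+1}$. For $\theta\in\mathbb Z[X]$ without zeros in $I$, let $\mathrm{sg}_I(\theta)\in\{1,-1\}$ be its constant sign on $I$. Define $\sigma_{I,0}=1$, $\sigma_{I,1}=\epsilon\,\mathrm{sg}_I(\tau_0)^\delta$ and $\sigma_{I,i+2}=\mathrm{sg}_I(\rho_{i+2}\tau_{i+1}\rho_{i+1}\tau_i)\,\sigma_{I,i}$,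 and let $f_{I,i}(x)=\sigma_{I,i}F_i(x,\varphi(x))$ for $0\le i\le N$. **Claim.** The quotients $F_i$ are indeed polynomials in $Y$ over $\mathbb Q(X)$, the denominators of their coefficients have no zero in $I$, and $(f_{I,0},\dots,f_{I,N})$ is a Sturm sequence in $I$ for $f$ with respect to $g$. The latter means that $f$, $g$ and all $f_{I,i}$ are continuous on $I$ and that for every $y\in I$: 1. $f_{I,0}(y)=0$ if and only if $f(y)=0$ and $g(y)\ne0$; 2. if $f_{I,0}(y)=0$, then there is $\varepsilon>0$ such that $(y-\varepsilon,y+\varepsilon)\subseteq I$, $f_{I,1}$ has no zero in $(y-\varepsilon,y+\varepsilon)$ and: if $g(y)>0$, then $f_{I,0}f_{I,1}$ is negative on $(y-\varepsilon,y)$ and positive on $(y,y+\varepsilon)$; if $g(y)<0$, then $f_{I,0}f_{I,1}$ is positive on $(y-\varepsilon,y)$ and negative on $(y,y+\varepsilon)$; 3. for $1\le i\le N-1$, if $f_{I,i}(y)=0$, then $f_{I,i-1}(y)f_{I,i+1}(y)<0$; 4. $f_{I,N}(y)\ne0$. -/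

import Mathlib

open Polynomial
open scoped Polynomial.Bivariate

namespace PfaffianSturm

noncomputable section

/-- A Sturm sequence `s 0, …, s N` on an open interval `I` for `f` with respect to `g`.
Only the values `s i` with `i ≤ N` matter (when `N = 0`, the last condition says that `s 0` has no
zero in `I`, so that the conditions `sign_of_pos`, `sign_of_neg` on `s 1` are void). -/
structure IsSturmSequence (I : Set ℝ) (f g : ℝ → ℝ) (N : ℕ) (s : ℕ → ℝ → ℝ) : Prop where
  continuousOn_left : ContinuousOn f I
  continuousOn_right : ContinuousOn g I
  continuousOn : ∀ i ≤ N, ContinuousOn (s i) I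
  zero_iff : ∀ y ∈ I, s 0 y = 0 ↔ f y = 0 ∧ g y ≠ 0
  sign_near_zero : ∀ y ∈ I, s 0 y = 0 → ∃ ε > 0, Set.Ioo (y - ε) (y + ε) ⊆ I ∧
    (∀ x ∈ Set.Ioo (y - ε) (y + ε), s 1 x ≠ 0) ∧
    (0 < g y →
      (∀ x ∈ Set.Ioo (y - ε) y, s 0 x * s 1 x < 0) ∧
      (∀ x ∈ Set.Ioo y (y + ε), 0 < s 0 x * s 1 x)) ∧
    (g y < 0 →
      (∀ x ∈ Set.Ioo (y - ε) y, 0 < s 0 x * s 1 x) ∧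
      (∀ x ∈ Set.Ioo y (y + ε), s 0 x * s 1 x < 0))
  neighbours : ∀ y ∈ I, ∀ i, 1 ≤ i → i + 1 ≤ N → s i y = 0 → s (i - 1) y * s (i + 1) y < 0
  last_ne_zero : ∀ y ∈ I, s N y ≠ 0

section Subresultants

variable {R : Type*} [CommRing R]

/-- The `r`-th entry of the list `Y^(q-j-1) P, …, Y P, P, Q, Y Q, …, Y^(p-j-1) Q`, where
`p = deg P`, `q = deg Q`. -/
def sylvesterHabichtRow (P Q : R[X]) (j r : ℕ) : R[X] :=
  if r < Q.natDegree - j then X ^ (Q.natDegree - j - 1 - r) * P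
  else X ^ (r - (Q.natDegree - j)) * Q

/-- The `j`-th (signed) subresultant polynomial of `P` and `Q`, for `j ≤ q = deg Q < p = deg P`: the
polynomial determinant of the `m = p + q - 2 j` polynomials listed in `sylvesterHabichtRow`.
Its coefficient of degree `k ≤ j` is the minor of the coefficient matrix (with respect to
the monomials of degree `p + q - j - 1, …, 1, 0`) on its first `m - 1` columns and the column of
the monomial of degree `k`. -/
def subresultant (P Q : R[X]) (j : ℕ) : R[X] :=
  ∑ k ∈ Finset.range (j + 1),
    C (Matrix.det (Matrix.of fun r c : Fin (P.natDegree + Q.natDegree - 2 * j) =>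
      (sylvesterHabichtRow P Q j r).coeff
        (if (c : ℕ) + 1 < P.natDegree + Q.natDegree - 2 * j
          then P.natDegree + Q.natDegree - j - 1 - c else k))) * X ^ k

theorem natDegree_subresultant_le (P Q : R[X]) (j : ℕ) : (subresultant P Q j).natDegree ≤ j := by
  refine natDegree_sum_le_of_forall_le _ _ fun k hk => ?_
  exact (natDegree_C_mul_X_pow_le _ _).trans (Nat.lt_succ_iff.mp (Finset.mem_range.mp hk))

end Subresultants

/-- `∂F/∂X` for `F ∈ ℤ[X][Y]`: the coefficients, which are polynomials in `X`, are derived. -/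
def derivX (F : ℤ[X][Y]) : ℤ[X][Y] := F.sum fun k c => monomial k (derivative c)

/-- `∂F/∂X + ∂F/∂Y · Φ`, the polynomial with `(F(x, φ(x)))' = (tilde Φ F)(x, φ(x))` whenever
`φ' = Φ(x, φ)`. -/
def tilde (Φ F : ℤ[X][Y]) : ℤ[X][Y] := derivX F + derivative F * Φ

variable (Φ F G : ℤ[X][Y])

/-- The subresultant polynomials `R_0 = F` and `R_{i+1} = SRes_{deg_Y(R_i) - 1}` of
`tilde Φ F * G` and `F` (with `SRes_{-1} = 0`, and continued by zero after the first zero term). -/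
def Rseq : ℕ → ℤ[X][Y]
  | 0 => F
  | i + 1 =>
    if (Rseq i).natDegree = 0 then 0
    else subresultant (tilde Φ F * G) F ((Rseq i).natDegree - 1)

/-- `N`, the largest `i` with `R_i ≠ 0`. -/
def lastIndex : ℕ := sSup {i | Rseq Φ F G i ≠ 0}

theorem natDegree_Rseq_add_le (i : ℕ) (hi : Rseq Φ F G i ≠ 0) :
    (Rseq Φ F G i).natDegree + i ≤ F.natDegree := by
  induction i with
  | zero => simp [Rseq]
  | succ i ih =>
    by_cases h : (Rseq Φ F G i).natDegree = 0
    · exact absurd (by rw [Rseq, if_pos h]) hi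
    · have h0 : Rseq Φ F G i ≠ 0 := fun h0 => h (by rw [h0, natDegree_zero])
      have h1 := ih h0
      have h2 := natDegree_subresultant_le (tilde Φ F * G) F ((Rseq Φ F G i).natDegree - 1)
      rw [Rseq, if_neg h]
      omega

/-- The supremum defining `N` is a maximum. -/
theorem isGreatest_lastIndex (hF : F ≠ 0) :
    IsGreatest {i | Rseq Φ F G i ≠ 0} (lastIndex Φ F G) := by
  have hb : BddAbove {i | Rseq Φ F G i ≠ 0} :=
    ⟨F.natDegree, fun i hi => (Nat.le_add_left _ _).trans (natDegree_Rseq_add_le Φ F G i hi)⟩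
  have hn : {i | Rseq Φ F G i ≠ 0}.Nonempty := ⟨0, by simpa [Rseq] using hF⟩
  exact ⟨Nat.sSup_mem hn hb, fun i hi => le_csSup hb hi⟩

/-- `τ_i ∈ ℤ[X]`, the leading coefficient of `R_i` as a polynomial in `Y`. -/
def tau (i : ℕ) : ℤ[X] := (Rseq Φ F G i).leadingCoeff

/-- `ρ_i ∈ ℤ[X]` for `i ≥ 1` (the value at `i = 0` is not used): with `n_i = deg_Y(R_{i-1})`, the
`n_i`-th subresultant coefficient of `tilde Φ F * G` and `F`. -/
def rho (i : ℕ) : ℤ[X] :=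
  (subresultant (tilde Φ F * G) F (Rseq Φ F G (i - 1)).natDegree).coeff
    (Rseq Φ F G (i - 1)).natDegree

/-- The inclusion of `ℤ[X]` in the field `ℚ(X)`. -/
def toRat : ℤ[X] →+* RatFunc ℚ :=
  (algebraMap ℚ[X] (RatFunc ℚ)).comp (mapRingHom (Int.castRingHom ℚ))

/-- `F_i = R_i / R_N ∈ ℚ(X)[Y]` (quotient of polynomials in `Y` over the field `ℚ(X)`). -/
def Fseq (i : ℕ) : Polynomial (RatFunc ℚ) :=
  (Rseq Φ F G i).map toRat / (Rseq Φ F G (lastIndex Φ F G)).map toRat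

/-- The value `H(x, y)` of `H ∈ ℚ(X)[Y]` at real numbers `x`, `y`. -/
def evalRat (H : Polynomial (RatFunc ℚ)) (x y : ℝ) : ℝ :=
  H.sum fun k c => c.eval (algebraMap ℚ ℝ) x * y ^ k

/-- The sign on the interval `I` of a polynomial `θ` that has no zero in `I`. -/
def sgn (I : Set ℝ) (θ : ℤ[X]) : ℤ :=
  open Classical in if ∀ x ∈ I, 0 < aeval x θ then 1 else -1

/-- `δ = deg_Y(tilde Φ F * G) - deg_Y(F) + 1`. -/
def delta : ℕ := (tilde Φ F * G).natDegree - F.natDegree + 1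

/-- The signs `σ_{I,i}`. -/
def sigma (I : Set ℝ) : ℕ → ℤ
  | 0 => 1
  | 1 => (-1) ^ (delta Φ F G * (delta Φ F G + 1) / 2) * sgn I (tau Φ F G 0) ^ delta Φ F G
  | i + 2 =>
    sgn I (rho Φ F G (i + 2) * tau Φ F G (i + 1) * rho Φ F G (i + 1) * tau Φ F G i) * sigma I i

/-- `f_{I,i}(x) = σ_{I,i} F_i(x, φ(x))`. -/
def sturmFun (I : Set ℝ) (φ : ℝ → ℝ) (i : ℕ) (x : ℝ) : ℝ :=
  (sigma Φ F G I i : ℝ) * evalRat (Fseq Φ F G i) x (φ x)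

end

end PfaffianSturm

/-!
Write `P = tilde Φ F * G`, so that `P(x, φ(x)) = f'(x) g(x)`, and `q = deg F < p = deg P`, the
degrees being taken in `Y`.

*Algebra.* Laplace expansion of the polynomial determinants gives cofactors `R_i = U_i P + V_i F`
with `deg V_{i+1} ≤ p - deg R_i`, where the coefficient of `V_{i+1}` in this degree is the leading
coefficient of `P` times `ρ_{i+1}` (`exists_cofactors_subresultant`). Since
`(U_i V_{i+1} - U_{i+1} V_i) P = R_i V_{i+1} - R_{i+1} V_i`, comparison of degrees and of leading
coefficients shows that the determinant of the transition matrix from `(P, F)` to `(R_i, R_{i+1})`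
is `τ_i ρ_{i+1}` (`IsCofactorSeq.det_succ`). All that is needed from the structure theorem of
subresultants follows by Cramer's rule, without Euclidean division:
`τ_i ρ_{i+1} R_{i+2} + τ_{i+1} ρ_{i+2} R_i` is a multiple of `R_{i+1}`, and, as `R_{N+1} = 0`, the
polynomial `R_N` divides `w P` and all `w R_i` for `w = τ_N ρ_{N+1}`, which has no zero in `I`
(`exists_isQuotientSeq`; if `R_N` has degree `0`, then `w = τ_N` will do). The remainder identity,
divided by `R_N`, is the sign condition on three consecutive functions
(`IsQuotientSeq.sturmFun_mul_neg`).

*Analysis.* Let `k` be the quotient of `P` by `R_N` along the graph of `φ`, and `f₀` that of `F`.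
Then `f₀ f' g = k f`, and `f₀`, `k` have no common zero. By noetherianity of `ℤ[X, Y]` the
derivatives of `f` satisfy a homogeneous linear differential equation, so that by Grönwall's
inequality `f` has only zeros of finite order (`exists_iterate_tilde_ne_zero`), and
`f / f' ~ (x - y) / m` at a zero `y` of order `m` (`exists_tendsto_div_deriv`). Hence
`f₀ = (f / f') (k / g)` has a sign change of the right kind where `f` vanishes and `g` does not,
whereas `f₀` and `g` cannot both vanish at `y`, since `f / f' = f₀ g / k` has order one. Finally,
`f₁` has the sign of `k` where `f₀ = 0`, since `R_1 = V_1 F - τ_0 ρ_1 P` and `ρ_1` is, up to an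
explicit sign, a power of `τ_0` (`sigma_one_mul_neg`).
-/

namespace PfaffianSturm

/-! ### Subresultants as combinations with cofactors -/

section Cofactors

variable {R : Type*} [CommRing R]

theorem coeff_subresultant (P Q : R[X]) {j k : ℕ} (hk : k ≤ j) (m : ℕ)
    (hm : m = P.natDegree + Q.natDegree - 2 * j) :
    (subresultant P Q j).coeff k = Matrix.det (Matrix.of fun r c : Fin m =>
      (sylvesterHabichtRow P Q j r).coeff
        (if (c : ℕ) + 1 < m then P.natDegree + Q.natDegree - j - 1 - c else k)) := by
  subst hm
  simp only [subresultant, finsetSum_coeff, coeff_C_mul_X_pow]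
  rw [Finset.sum_ite_eq (Finset.range (j + 1)) k, if_pos (Finset.mem_range.mpr (by omega))]

theorem natDegree_sylvesterHabichtRow_le (P Q : R[X]) {j : ℕ} (hj : j ≤ Q.natDegree)
    (r : ℕ) :
    (sylvesterHabichtRow P Q j r).natDegree ≤
      if r < Q.natDegree - j then P.natDegree + Q.natDegree - j - 1 - r else r + j := by
  unfold sylvesterHabichtRow
  split_ifs with h
  · refine natDegree_mul_le.trans ?_
    have := natDegree_X_pow_le (R := R) (Q.natDegree - j - 1 - r)
    omega
  · refine natDegree_mul_le.trans ?_
    have := natDegree_X_pow_le (R := R) (r - (Q.natDegree - j))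
    omega

/-- Deleting the last row and the last column of the matrix of the `l`-th subresultant leaves, after
expansion along the first column, the matrix of the `(l + 1)`-st subresultant coefficient. -/
theorem det_sylvesterHabicht_submatrix (P Q : R[X]) {l : ℕ} (hl : l < Q.natDegree)
    (hPQ : Q.natDegree < P.natDegree) (n : ℕ)
    (hn : n = P.natDegree + Q.natDegree - 2 * (l + 1)) :
    Matrix.det (Matrix.of fun r c : Fin (n + 1) => (sylvesterHabichtRow P Q l r).coeff
        (P.natDegree + Q.natDegree - l - 1 - c)) =
      P.leadingCoeff * (subresultant P Q (l + 1)).coeff (l + 1) := by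
  rw [Matrix.det_succ_column_zero, Fin.sum_univ_succ, Finset.sum_eq_zero, add_zero,
    coeff_subresultant P Q le_rfl n hn]
  · have h0 : (sylvesterHabichtRow P Q l 0).coeff (P.natDegree + Q.natDegree - l - 1) =
        P.leadingCoeff := by
      rw [sylvesterHabichtRow, if_pos (by omega),
        show P.natDegree + Q.natDegree - l - 1 = P.natDegree + (Q.natDegree - l - 1 - 0) by omega,
        coeff_X_pow_mul, leadingCoeff]
    simp only [Matrix.of_apply, Fin.val_zero, pow_zero, one_mul, Nat.sub_zero, h0]
    congr 2
    ext r c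
    have hr := r.2
    have hc := c.2
    have hrow : sylvesterHabichtRow P Q l (r + 1) = sylvesterHabichtRow P Q (l + 1) r := by
      unfold sylvesterHabichtRow
      split_ifs
      · congr 2; omega
      · omega
      · omega
      · congr 2; omega
    simp only [Matrix.submatrix_apply, Matrix.of_apply, Fin.succAbove_zero, Fin.val_succ, hrow]
    congr 1
    split_ifs <;> omega
  · intro i _
    have hi := i.2
    have h := natDegree_sylvesterHabichtRow_le P Q hl.le (i + 1)
    have : (sylvesterHabichtRow P Q l (i + 1)).coeff (P.natDegree + Q.natDegree - l - 1) = 0 := by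
      apply coeff_eq_zero_of_natDegree_lt
      split_ifs at h <;> omega
    simp [this]

/-- Laplace expansion of the polynomial determinant along its last column writes the `l`-th
subresultant as `U * P + V * Q`. The coefficient of `V` of highest possible degree is the cofactor
of the last entry, that is, up to the leading coefficient of `P`, the next subresultant coefficient. -/
theorem exists_cofactors_subresultant (P Q : R[X]) {l : ℕ} (hl : l < Q.natDegree)
    (hPQ : Q.natDegree < P.natDegree) :
    ∃ U V : R[X], subresultant P Q l = U * P + V * Q ∧ V.natDegree ≤ P.natDegree - (l + 1) ∧
      V.coeff (P.natDegree - (l + 1)) =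
        P.leadingCoeff * (subresultant P Q (l + 1)).coeff (l + 1) := by
  obtain ⟨n, hn⟩ : ∃ n, n = P.natDegree + Q.natDegree - 2 * (l + 1) := ⟨_, rfl⟩
  have hm : n + 1 + 1 = P.natDegree + Q.natDegree - 2 * l := by omega
  let M : Matrix (Fin (n + 1 + 1)) (Fin (n + 1 + 1)) R := Matrix.of fun r c =>
    (sylvesterHabichtRow P Q l r).coeff (P.natDegree + Q.natDegree - l - 1 - c)
  let a : Fin (n + 1 + 1) → R := fun r => M.adjugate (Fin.last _) r
  have hlast : a (Fin.last _) = P.leadingCoeff * (subresultant P Q (l + 1)).coeff (l + 1) := by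
    rw [← det_sylvesterHabicht_submatrix P Q hl hPQ n hn]
    simp only [a, Matrix.adjugate_fin_succ_eq_det_submatrix, Fin.succAbove_last]
    rw [Even.neg_one_pow ⟨_, rfl⟩, one_mul]
    rfl
  have hsum : subresultant P Q l = ∑ r, C (a r) * sylvesterHabichtRow P Q l r := by
    ext k
    have hdet : (∑ r, C (a r) * sylvesterHabichtRow P Q l r).coeff k =
        (M.updateCol (Fin.last _) fun r => (sylvesterHabichtRow P Q l r).coeff k).det := by
      rw [← Matrix.cramer_apply, Matrix.cramer_eq_adjugate_mulVec]
      simp [Matrix.mulVec, dotProduct, a]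
    rw [hdet]
    rcases le_or_gt k l with hk | hk
    · rw [coeff_subresultant P Q hk _ hm]
      congr 1
      ext r c
      have hc := c.2
      rw [Matrix.updateCol_apply]
      by_cases h : c = Fin.last _
      · simp [h]
      · have : (c : ℕ) ≠ n + 1 := fun h' => h (Fin.ext h')
        simp only [Matrix.of_apply, if_neg h, M]
        rw [if_pos (by omega)]
    · rw [coeff_eq_zero_of_natDegree_lt ((natDegree_subresultant_le P Q l).trans_lt hk)]
      symm
      rcases le_or_gt k (P.natDegree + Q.natDegree - l - 1) with hk' | hk'
      · -- the last column repeats the column of the monomial of degree `k`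
        have hlt : P.natDegree + Q.natDegree - l - 1 - k < n + 1 := by omega
        have hne : (⟨P.natDegree + Q.natDegree - l - 1 - k, by omega⟩ : Fin (n + 1 + 1)) ≠
            Fin.last _ := fun h => by simp [Fin.ext_iff] at h; omega
        refine Matrix.det_zero_of_column_eq hne fun r => ?_
        rw [Matrix.updateCol_self, Matrix.updateCol_ne hne]
        simp only [M, Matrix.of_apply]
        congr 1
        omega
      · refine Matrix.det_eq_zero_of_column_eq_zero (Fin.last _) fun r => ?_
        rw [Matrix.updateCol_self]
        have hr := r.2
        have h := natDegree_sylvesterHabichtRow_le P Q hl.le r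
        apply coeff_eq_zero_of_natDegree_lt
        split_ifs at h <;> omega
  refine ⟨∑ r : Fin (n + 1 + 1), if (r : ℕ) < Q.natDegree - l then
      C (a r) * X ^ (Q.natDegree - l - 1 - r) else 0,
    ∑ r : Fin (n + 1 + 1), if (r : ℕ) < Q.natDegree - l then 0 else
      C (a r) * X ^ (r - (Q.natDegree - l)), ?_, ?_, ?_⟩
  · rw [hsum, Finset.sum_mul, Finset.sum_mul, ← Finset.sum_add_distrib]
    refine Finset.sum_congr rfl fun r _ => ?_
    unfold sylvesterHabichtRow
    split_ifs <;> ring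
  · refine natDegree_sum_le_of_forall_le _ _ fun r _ => ?_
    have hr := r.2
    split_ifs
    · simp
    · refine (natDegree_C_mul_X_pow_le _ _).trans ?_
      omega
  · rw [← hlast, finsetSum_coeff, Finset.sum_eq_single (Fin.last _)]
    · rw [if_neg (by simp; omega), coeff_C_mul_X_pow, if_pos (by simp; omega)]
    · intro r _ hr
      have hr' : (r : ℕ) ≠ n + 1 := fun h' => hr (Fin.ext h')
      have := r.2
      split_ifs
      · simp
      · rw [coeff_C_mul_X_pow, if_neg (by omega)]
    · simp

/-- The matrix is zero above the antidiagonal, which consists of leading coefficients. -/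
theorem det_coeff_X_pow_mul (Q : R[X]) (n : ℕ) :
    Matrix.det (Matrix.of fun r c : Fin n => (X ^ (r : ℕ) * Q).coeff (Q.natDegree + n - 1 - c)) =
      (-1) ^ (n * (n - 1) / 2) * Q.leadingCoeff ^ n := by
  induction n with
  | zero => simp
  | succ n ih =>
    rw [Matrix.det_succ_row_zero, Finset.sum_eq_single (Fin.last n)]
    · have hsub : (Matrix.of fun r c : Fin (n + 1) =>
          (X ^ (r : ℕ) * Q).coeff (Q.natDegree + (n + 1) - 1 - c)).submatrix Fin.succ
            (Fin.last n).succAbove =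
          Matrix.of fun r c : Fin n =>
            (X ^ (r : ℕ) * Q).coeff (Q.natDegree + n - 1 - c) := by
        ext r c
        have hc := c.2
        simp only [Matrix.submatrix_apply, Matrix.of_apply, Fin.succAbove_last, Fin.val_succ,
          Fin.val_castSucc]
        rw [show Q.natDegree + (n + 1) - 1 - (c : ℕ) = Q.natDegree + n - 1 - c + 1 by omega,
          pow_succ', mul_assoc, coeff_X_mul]
      have hexp : (n + 1) * (n + 1 - 1) / 2 = n + n * (n - 1) / 2 := by
        rw [Nat.triangle_succ, add_comm]
      rw [hsub, ih, hexp]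
      simp only [Matrix.of_apply, Fin.val_last, Fin.val_zero, pow_zero, one_mul]
      rw [show Q.natDegree + (n + 1) - 1 - n = Q.natDegree by omega, coeff_natDegree]
      ring
    · intro c _ hc
      have hc' : (c : ℕ) ≠ n := fun h' => hc (Fin.ext h')
      have := c.2
      have : Q.coeff (Q.natDegree + (n + 1) - 1 - c) = 0 :=
        coeff_eq_zero_of_natDegree_lt (by omega)
      simp only [Matrix.of_apply, Fin.val_zero, pow_zero, one_mul, this, mul_zero, zero_mul]
    · simp

theorem coeff_natDegree_subresultant (P Q : R[X]) :
    (subresultant P Q Q.natDegree).coeff Q.natDegree =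
      (-1) ^ ((P.natDegree - Q.natDegree) * (P.natDegree - Q.natDegree - 1) / 2) *
        Q.leadingCoeff ^ (P.natDegree - Q.natDegree) := by
  rw [← det_coeff_X_pow_mul, coeff_subresultant P Q le_rfl (P.natDegree - Q.natDegree) (by omega)]
  congr 1
  ext r c
  have hc := c.2
  simp only [Matrix.of_apply, sylvesterHabichtRow, Nat.sub_self, Nat.not_lt_zero, if_false,
    Nat.sub_zero]
  congr 1
  split_ifs <;> omega

end Cofactors

/-! ### Cofactors and quotients of the subresultant sequence -/

theorem coeff_derivX (F : ℤ[X][Y]) (k : ℕ) : (derivX F).coeff k = derivative (F.coeff k) := by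
  rw [derivX, sum_def, finsetSum_coeff]
  simp only [coeff_monomial]
  rw [Finset.sum_ite_eq']
  split_ifs with h
  · rfl
  · rw [notMem_support_iff.mp h, derivative_zero]

/-- The coefficient of `Y ^ (deg F - 1 + deg Φ)` in `tilde Φ F` does not vanish: it is
`a' + deg F * a * b` or `deg F * a * b` with the leading coefficients `a` of `F` and `b` of `Φ`, and
`a` cannot divide its derivative unless this is zero. -/
theorem natDegree_le_natDegree_tilde {Φ F : ℤ[X][Y]} (hΦ : 0 < Φ.natDegree)
    (hF : 0 < F.natDegree) : F.natDegree ≤ (tilde Φ F).natDegree := by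
  have hF0 : F ≠ 0 := ne_zero_of_natDegree_gt hF
  have hΦ0 : Φ ≠ 0 := ne_zero_of_natDegree_gt hΦ
  have hd : (derivative F).natDegree = F.natDegree - 1 := natDegree_derivative F
  have hcoeff : (tilde Φ F).coeff (F.natDegree - 1 + Φ.natDegree) =
      derivative (F.coeff (F.natDegree - 1 + Φ.natDegree)) +
        F.leadingCoeff * F.natDegree * Φ.leadingCoeff := by
    rw [tilde, coeff_add, coeff_derivX]
    congr 1
    rw [← hd, coeff_mul_degree_add_degree, leadingCoeff, hd, coeff_derivative, ← Nat.cast_succ,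
      Nat.succ_eq_add_one, Nat.sub_add_cancel hF]
    rfl
  refine le_trans ?_ (le_natDegree_of_ne_zero (n := F.natDegree - 1 + Φ.natDegree) ?_)
  · omega
  rw [hcoeff]
  have hne : F.leadingCoeff * F.natDegree * Φ.leadingCoeff ≠ 0 := by
    refine mul_ne_zero (mul_ne_zero (leadingCoeff_ne_zero.mpr hF0) ?_)
      (leadingCoeff_ne_zero.mpr hΦ0)
    exact_mod_cast hF.ne'
  rcases Nat.lt_or_ge 1 Φ.natDegree with h1 | h1
  · rwa [coeff_eq_zero_of_natDegree_lt (by omega : F.natDegree < _), derivative_zero, zero_add]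
  · rw [show F.natDegree - 1 + Φ.natDegree = F.natDegree by omega, coeff_natDegree]
    intro h
    have hdvd : F.leadingCoeff ∣ derivative F.leadingCoeff :=
      ⟨-(F.natDegree * Φ.leadingCoeff), by linear_combination h⟩
    have h0 : derivative F.leadingCoeff = 0 :=
      eq_zero_of_dvd_of_degree_lt hdvd (degree_derivative_lt (leadingCoeff_ne_zero.mpr hF0))
    rw [h0, zero_add] at h
    exact hne h

theorem natDegree_lt_natDegree_tilde_mul {Φ F G : ℤ[X][Y]} (hΦ : 0 < Φ.natDegree)
    (hF : 0 < F.natDegree) (hG : 0 < G.natDegree) :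
    F.natDegree < (tilde Φ F * G).natDegree := by
  have h := natDegree_le_natDegree_tilde hΦ hF
  rw [natDegree_mul (ne_zero_of_natDegree_gt (hF.trans_le h)) (ne_zero_of_natDegree_gt hG)]
  omega

variable {Φ F G : ℤ[X][Y]}

theorem natDegree_Rseq_succ_le (i : ℕ) :
    (Rseq Φ F G (i + 1)).natDegree ≤ (Rseq Φ F G i).natDegree - 1 := by
  rw [Rseq]
  split_ifs with h
  · simp
  · exact natDegree_subresultant_le _ _ _

theorem natDegree_Rseq_le (i : ℕ) : (Rseq Φ F G i).natDegree ≤ F.natDegree := by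
  induction i with
  | zero => rfl
  | succ i ih => exact (natDegree_Rseq_succ_le i).trans (by omega)

theorem Rseq_ne_zero (hF : F ≠ 0) {i : ℕ} (hi : i ≤ lastIndex Φ F G) : Rseq Φ F G i ≠ 0 := by
  refine Nat.decreasingInduction (motive := fun i _ => Rseq Φ F G i ≠ 0) (fun k _ hk h => ?_)
    (isGreatest_lastIndex Φ F G hF).1 hi
  exact hk (by rw [Rseq, if_pos (by rw [h, natDegree_zero])])

theorem natDegree_Rseq_pos (hF : F ≠ 0) {i : ℕ} (hi : i < lastIndex Φ F G) :
    0 < (Rseq Φ F G i).natDegree := by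
  refine Nat.pos_of_ne_zero fun h => Rseq_ne_zero hF (Nat.succ_le_of_lt hi) ?_
  rw [Rseq, if_pos h]

theorem Rseq_lastIndex_succ (hF : F ≠ 0) : Rseq Φ F G (lastIndex Φ F G + 1) = 0 := by
  by_contra h
  exact absurd ((isGreatest_lastIndex Φ F G hF).2 h) (by omega)

/-- `U i` and `V i` are cofactors of `R_i`, that is, `R_i = U i * P + V i * F` where
`P = tilde Φ F * G`, with the degree bound of the subresultants. -/
structure IsCofactorSeq (Φ F G : ℤ[X][Y]) (U V : ℕ → ℤ[X][Y]) : Prop where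
  left_zero : U 0 = 0
  right_zero : V 0 = 1
  eq (i : ℕ) : Rseq Φ F G i = U i * (tilde Φ F * G) + V i * F
  natDegree_le (i : ℕ) (hi : 0 < (Rseq Φ F G i).natDegree) :
    (V (i + 1)).natDegree ≤ (tilde Φ F * G).natDegree - (Rseq Φ F G i).natDegree
  coeff (i : ℕ) (hi : 0 < (Rseq Φ F G i).natDegree) :
    (V (i + 1)).coeff ((tilde Φ F * G).natDegree - (Rseq Φ F G i).natDegree) =
      (tilde Φ F * G).leadingCoeff * rho Φ F G (i + 1)

theorem exists_isCofactorSeq (hPF : F.natDegree < (tilde Φ F * G).natDegree) :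
    ∃ U V, IsCofactorSeq Φ F G U V := by
  have key (i : ℕ) : ∃ U V : ℤ[X][Y], Rseq Φ F G (i + 1) = U * (tilde Φ F * G) + V * F ∧
      (0 < (Rseq Φ F G i).natDegree →
        V.natDegree ≤ (tilde Φ F * G).natDegree - (Rseq Φ F G i).natDegree ∧
        V.coeff ((tilde Φ F * G).natDegree - (Rseq Φ F G i).natDegree) =
          (tilde Φ F * G).leadingCoeff * rho Φ F G (i + 1)) := by
    rcases Nat.eq_zero_or_pos (Rseq Φ F G i).natDegree with h | h
    · exact ⟨0, 0, by rw [Rseq, if_pos h]; simp, by omega⟩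
    · have hle : (Rseq Φ F G i).natDegree ≤ F.natDegree := natDegree_Rseq_le i
      obtain ⟨U, V, h1, h2, h3⟩ := exists_cofactors_subresultant (tilde Φ F * G) F
        (l := (Rseq Φ F G i).natDegree - 1) (by omega) hPF
      rw [Nat.sub_add_cancel h] at h2 h3
      exact ⟨U, V, by rw [Rseq, if_neg h.ne', h1], fun _ => ⟨h2, h3⟩⟩
  choose U V h1 h2 using key
  refine ⟨fun i => Nat.casesOn i 0 U, fun i => Nat.casesOn i 1 V, rfl, rfl, ?_,
    fun i hi => (h2 i hi).1, fun i hi => (h2 i hi).2⟩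
  rintro (_ | i)
  · simp [Rseq]
  · exact h1 i

namespace IsCofactorSeq

variable {U V : ℕ → ℤ[X][Y]} (h : IsCofactorSeq Φ F G U V)
include h

theorem det_mul_left (i j : ℕ) : (U i * V j - U j * V i) * (tilde Φ F * G) =
    Rseq Φ F G i * V j - Rseq Φ F G j * V i := by
  rw [h.eq i, h.eq j]; ring

theorem det_mul_right (i j : ℕ) : (U i * V j - U j * V i) * F =
    Rseq Φ F G j * U i - Rseq Φ F G i * U j := by
  rw [h.eq i, h.eq j]; ring

/-- The determinant of the transition matrix from `(P, F)` to `(R_i, R_{i+1})` does not involve `Y`.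
The product of this determinant and `P` is `R_i * V (i + 1) - R_{i+1} * V i`, which has the degree
of `P` by the bounds on the cofactors. Comparison of the leading coefficients yields the value. -/
theorem det_succ (hPF : F.natDegree < (tilde Φ F * G).natDegree) (i : ℕ)
    (hi : 0 < (Rseq Φ F G i).natDegree) :
    U i * V (i + 1) - U (i + 1) * V i = C (tau Φ F G i * rho Φ F G (i + 1)) := by
  have hP0 : tilde Φ F * G ≠ 0 := ne_zero_of_natDegree_gt hPF
  have hmul := h.det_mul_left i (i + 1)
  have hle : (Rseq Φ F G i).natDegree ≤ F.natDegree := natDegree_Rseq_le i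
  have hsucc : (Rseq Φ F G (i + 1)).natDegree ≤ (Rseq Φ F G i).natDegree - 1 :=
    natDegree_Rseq_succ_le i
  have hV : (V i).natDegree ≤ (tilde Φ F * G).natDegree - (Rseq Φ F G i).natDegree := by
    rcases i with _ | i
    · simp [h.right_zero]
    · have h' : (Rseq Φ F G (i + 1)).natDegree ≤ (Rseq Φ F G i).natDegree - 1 :=
        natDegree_Rseq_succ_le i
      exact (h.natDegree_le i (by omega)).trans (by omega)
  have hV' := h.natDegree_le i hi
  have h1 : (Rseq Φ F G i * V (i + 1)).natDegree ≤ (tilde Φ F * G).natDegree :=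
    natDegree_mul_le.trans (by omega)
  have h2 : (Rseq Φ F G (i + 1) * V i).natDegree < (tilde Φ F * G).natDegree :=
    natDegree_mul_le.trans_lt (by omega)
  have hcoeff : (Rseq Φ F G i * V (i + 1) - Rseq Φ F G (i + 1) * V i).coeff
      (tilde Φ F * G).natDegree =
        tau Φ F G i * ((tilde Φ F * G).leadingCoeff * rho Φ F G (i + 1)) := by
    rw [coeff_sub, coeff_eq_zero_of_natDegree_lt h2, sub_zero, ← h.coeff i hi, tau, leadingCoeff,
      ← coeff_mul_add_eq_of_natDegree_le le_rfl hV',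
      Nat.add_sub_cancel' (hle.trans hPF.le)]
  set W := U i * V (i + 1) - U (i + 1) * V i with hW
  have hdeg : W.natDegree = 0 := by
    by_contra hne
    have hW0 : W ≠ 0 := fun h0 => hne (by rw [h0, natDegree_zero])
    have h3 := natDegree_mul hW0 hP0
    have h4 : (W * (tilde Φ F * G)).natDegree ≤ (tilde Φ F * G).natDegree := by
      rw [hmul]
      exact (natDegree_sub_le _ _).trans (max_le h1 h2.le)
    omega
  obtain ⟨w, hw⟩ := natDegree_eq_zero.mp hdeg
  rw [← hmul, ← hw, coeff_C_mul, coeff_natDegree] at hcoeff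
  rw [← hw]
  congr 1
  exact mul_right_cancel₀ (leadingCoeff_ne_zero.mpr hP0) (by rw [hcoeff]; ring)

end IsCofactorSeq

/-- The polynomials `Q i` and `QP` are the quotients of `R_i` and of `P = tilde Φ F * G` by `R_N`,
up to the common denominator `w`, which is a product of some of the `τ_i` and `ρ_i`. The remaining
fields are the identities of the Euclidean algorithm, divided by `R_N`. -/
structure IsQuotientSeq (Φ F G : ℤ[X][Y]) (w : ℤ[X]) (Q : ℕ → ℤ[X][Y]) (QP : ℤ[X][Y]) :
    Prop where
  denom : w = tau Φ F G (lastIndex Φ F G) ∨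
    w = tau Φ F G (lastIndex Φ F G) * rho Φ F G (lastIndex Φ F G + 1)
  mul_eq (i : ℕ) : C w * Rseq Φ F G i = Rseq Φ F G (lastIndex Φ F G) * Q i
  last : Q (lastIndex Φ F G) = C w
  cross : Q 0 * (tilde Φ F * G) = QP * F
  bezout : ∃ U V, U * QP + V * Q 0 = C w
  bezout_succ (i : ℕ) (hi : i + 1 ≤ lastIndex Φ F G) : ∃ A B,
    A * Q i + B * Q (i + 1) = C (tau Φ F G i * rho Φ F G (i + 1) * w)
  first (h : 1 ≤ lastIndex Φ F G) : ∃ A, Q 1 = A * Q 0 - C (tau Φ F G 0 * rho Φ F G 1) * QP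
  step (i : ℕ) (hi : i + 2 ≤ lastIndex Φ F G) : ∃ A,
    C (tau Φ F G i * rho Φ F G (i + 1)) * Q (i + 2) +
      C (tau Φ F G (i + 1) * rho Φ F G (i + 2)) * Q i = A * Q (i + 1)

/-- As `R_{N+1} = 0`, the identities for the transition matrix from `(P, F)` to `(R_N, R_{N+1})`
exhibit its determinant times `P` and `F`, hence times all `R_i`, as multiples of `R_N`. -/
theorem exists_isQuotientSeq (hF : F ≠ 0) (hPF : F.natDegree < (tilde Φ F * G).natDegree)
    (hτ : tau Φ F G (lastIndex Φ F G) ≠ 0) (hρ : rho Φ F G (lastIndex Φ F G + 1) ≠ 0) :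
    ∃ w Q QP, IsQuotientSeq Φ F G w Q QP := by
  obtain ⟨U, V, h⟩ := exists_isCofactorSeq hPF
  set N := lastIndex Φ F G with hN
  have hRN : Rseq Φ F G N ≠ 0 := Rseq_ne_zero hF le_rfl
  -- the exact quotients, first in any form
  obtain ⟨w, Q, QP, hw, hQ, hQP⟩ : ∃ (w : ℤ[X]) (Q : ℕ → ℤ[X][Y]) (QP : ℤ[X][Y]),
      (w = tau Φ F G N ∨ w = tau Φ F G N * rho Φ F G (N + 1)) ∧
      (∀ i, C w * Rseq Φ F G i = Rseq Φ F G N * Q i) ∧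
      C w * (tilde Φ F * G) = Rseq Φ F G N * QP := by
    rcases Nat.eq_zero_or_pos (Rseq Φ F G N).natDegree with h0 | h0
    · have hC : C (tau Φ F G N) = Rseq Φ F G N := by
        conv_rhs => rw [eq_C_of_natDegree_eq_zero h0]
        rw [tau, leadingCoeff, h0]
      exact ⟨tau Φ F G N, Rseq Φ F G, tilde Φ F * G, Or.inl rfl, fun i => by rw [hC], by rw [hC]⟩
    · -- here `R_N` divides `W * P` and `W * F` for the determinant `W` because `R_{N+1} = 0`
      have hdet := h.det_succ hPF N h0
      have hP := h.det_mul_left N (N + 1)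
      have hF' := h.det_mul_right N (N + 1)
      rw [hdet, Rseq_lastIndex_succ hF] at hP hF'
      refine ⟨tau Φ F G N * rho Φ F G (N + 1), fun i => U i * V (N + 1) - V i * U (N + 1),
        V (N + 1), Or.inr rfl, fun i => ?_, by rw [hP]; ring⟩
      rw [h.eq i]
      linear_combination U i * hP + V i * hF'
  have hw0 : w ≠ 0 := by
    rcases hw with rfl | rfl
    · exact hτ
    · exact mul_ne_zero hτ hρ
  have hCw : (C w : ℤ[X][Y]) ≠ 0 := C_ne_zero.mpr hw0
  have hQF : C w * F = Rseq Φ F G N * Q 0 := hQ 0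
  have hQeq (i : ℕ) : Q i = U i * QP + V i * Q 0 := by
    apply mul_left_cancel₀ hRN
    rw [← hQ i, h.eq i]
    linear_combination U i * hQP + V i * hQF
  have hlast : Q N = C w := mul_left_cancel₀ hRN (by rw [← hQ N, mul_comm])
  refine ⟨w, Q, QP, hw, hQ, hlast, ?_, ⟨U N, V N, by rw [← hQeq, hlast]⟩, fun i hi => ?_,
    fun h1 => ⟨V 1, ?_⟩, fun i hi => ⟨U i * V (i + 2) - U (i + 2) * V i, ?_⟩⟩
  · apply mul_left_cancel₀ hRN
    linear_combination F * hQP - tilde Φ F * G * hQF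
  · have hdet := h.det_succ hPF i (natDegree_Rseq_pos hF hi)
    refine ⟨U N * V (i + 1) - V N * U (i + 1), V N * U i - U N * V i, ?_⟩
    rw [C_mul, ← hdet, ← hlast, hQeq i, hQeq (i + 1), hQeq N]
    ring
  · have hdet := h.det_succ hPF 0 (natDegree_Rseq_pos hF h1)
    rw [← hdet, hQeq 1, h.left_zero, h.right_zero]
    ring
  · rw [← h.det_succ hPF i (natDegree_Rseq_pos hF (by omega)),
      ← h.det_succ hPF (i + 1) (natDegree_Rseq_pos hF (by omega)), hQeq i, hQeq (i + 1),
      hQeq (i + 2)]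
    ring

/-! ### Evaluation of the quotients at real points -/

theorem toRat_injective : Function.Injective toRat :=
  (RatFunc.algebraMap_injective ℚ).comp (map_injective _ (RingHom.injective_int _))

theorem aevalAeval_eq_sum_range (x y : ℝ) (Q : ℤ[X][Y]) {n : ℕ} (hn : Q.natDegree < n) :
    aevalAeval x y Q = ∑ k ∈ Finset.range n, aeval x (Q.coeff k) * y ^ k := by
  conv_lhs => rw [as_sum_range_C_mul_X_pow' Q hn]
  simp only [map_sum, map_mul, map_pow, aevalAeval_C, aevalAeval_Y]

theorem aeval_map_intCast (x : ℝ) (θ : ℤ[X]) :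
    aeval x (mapRingHom (Int.castRingHom ℚ) θ) = aeval x θ :=
  aeval_map_algebraMap ℚ x θ

section

variable {c : RatFunc ℚ} {w a : ℤ[X]} {x : ℝ}

theorem aeval_denom_ne_zero (hc : toRat w * c = toRat a) (hw : aeval x w ≠ 0) :
    aeval x c.denom ≠ 0 := by
  have hw0 : toRat w ≠ 0 := by
    rw [Ne, map_eq_zero_iff _ toRat_injective]
    rintro rfl
    simp at hw
  have h := RatFunc.denom_div_dvd (mapRingHom (Int.castRingHom ℚ) a)
    (mapRingHom (Int.castRingHom ℚ) w)
  have hc' : c = toRat a / toRat w := by rw [← hc, mul_div_cancel_left₀ _ hw0]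
  rw [show algebraMap ℚ[X] (RatFunc ℚ) _ / algebraMap ℚ[X] (RatFunc ℚ) _ = c from hc'.symm] at h
  intro h0
  have h1 := _root_.map_dvd (aeval x) h
  rw [h0, aeval_map_intCast, zero_dvd_iff] at h1
  exact hw h1

theorem eval_eq_div (hc : toRat w * c = toRat a) (hw : aeval x w ≠ 0) :
    c.eval (algebraMap ℚ ℝ) x = aeval x a / aeval x w := by
  have hd := aeval_denom_ne_zero hc hw
  have h := RatFunc.eval_mul (f := algebraMap ℚ ℝ) (a := x) (x := toRat w) (y := c)
    (by simp [toRat]) hd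
  rw [hc] at h
  simp only [toRat, RingHom.comp_apply, RatFunc.eval_algebraMap] at h
  rw [eq_div_iff hw, mul_comm]
  simp only [Algebra.algebraMap_self, RingHom.id_apply, ← aeval_def, aeval_map_intCast] at h
  exact h.symm

end

theorem evalRat_eq_div {H : Polynomial (RatFunc ℚ)} {Q : ℤ[X][Y]} {w : ℤ[X]}
    (hH : C (toRat w) * H = Q.map toRat) {x : ℝ} (hw : aeval x w ≠ 0) (y : ℝ) :
    evalRat H x y = aevalAeval x y Q / aeval x w := by
  have hle : Q.natDegree < max Q.natDegree H.natDegree + 1 :=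
    Nat.lt_succ_of_le (le_max_left _ _)
  have hle' : H.natDegree < max Q.natDegree H.natDegree + 1 :=
    Nat.lt_succ_of_le (le_max_right _ _)
  rw [evalRat, sum_over_range' H (fun k => by simp) _ hle', aevalAeval_eq_sum_range x y Q hle,
    Finset.sum_div]
  refine Finset.sum_congr rfl fun k _ => ?_
  rw [eval_eq_div (w := w) (a := Q.coeff k) (by rw [← coeff_C_mul, hH, coeff_map]) hw,
    div_mul_eq_mul_div]

section

variable {Φ F G : ℤ[X][Y]} {w : ℤ[X]} {Q : ℕ → ℤ[X][Y]} {QP : ℤ[X][Y]}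

theorem IsQuotientSeq.C_mul_Fseq (h : IsQuotientSeq Φ F G w Q QP) (hF : F ≠ 0) (hw : w ≠ 0)
    (i : ℕ) : C (toRat w) * Fseq Φ F G i = (Q i).map toRat := by
  have hRN : (Rseq Φ F G (lastIndex Φ F G)).map toRat ≠ 0 :=
    (Polynomial.map_ne_zero_iff toRat_injective).mpr (Rseq_ne_zero hF le_rfl)
  have hw' : toRat w ≠ 0 := (map_ne_zero_iff _ toRat_injective).mpr hw
  have hmul := congrArg (Polynomial.map toRat) (h.mul_eq i)
  rw [Polynomial.map_mul, Polynomial.map_mul, map_C] at hmul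
  have hR : (Rseq Φ F G i).map toRat =
      (Rseq Φ F G (lastIndex Φ F G)).map toRat * (C (toRat w)⁻¹ * (Q i).map toRat) := by
    rw [mul_left_comm, ← hmul, ← mul_assoc, ← C_mul, inv_mul_cancel₀ hw', C_1, one_mul]
  rw [Fseq, hR, mul_div_cancel_left₀ _ hRN, ← mul_assoc, ← C_mul,
    mul_inv_cancel₀ hw', C_1, one_mul]

end

/-! ### Signs -/

theorem sgn_eq (I : Set ℝ) (θ : ℤ[X]) : sgn I θ = 1 ∨ sgn I θ = -1 := by
  unfold sgn
  split_ifs <;> simp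

theorem sgn_mul_aeval_pos {I : Set ℝ} (hI : I.OrdConnected) {θ : ℤ[X]}
    (hθ : ∀ x ∈ I, aeval x θ ≠ 0) {x : ℝ} (hx : x ∈ I) : 0 < (sgn I θ : ℝ) * aeval x θ := by
  unfold sgn
  split_ifs with h
  · simpa using h x hx
  · push Not at h
    obtain ⟨z, hz, hz0⟩ := h
    have hx0 : aeval x θ < 0 := by
      by_contra! hpos
      obtain ⟨t, ht, ht0⟩ := hI.isPreconnected.intermediate_value hz hx
        (Polynomial.continuous_aeval θ).continuousOn ⟨hz0, hpos⟩
      exact hθ t ht ht0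
    simpa using hx0

theorem sigma_eq (Φ F G : ℤ[X][Y]) (I : Set ℝ) (i : ℕ) :
    sigma Φ F G I i = 1 ∨ sigma Φ F G I i = -1 := by
  have hmul {a b : ℤ} : (a = 1 ∨ a = -1) → (b = 1 ∨ b = -1) → (a * b = 1 ∨ a * b = -1) := by
    rintro (rfl | rfl) (rfl | rfl) <;> simp
  have hpow {a : ℤ} (ha : a = 1 ∨ a = -1) (n : ℕ) : a ^ n = 1 ∨ a ^ n = -1 := by
    induction n with
    | zero => simp
    | succ n ih => rw [pow_succ]; exact hmul ih ha
  induction i using Nat.twoStepInduction with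
  | zero => exact Or.inl rfl
  | one => exact hmul (hpow (Or.inr rfl) _) (hpow (sgn_eq _ _) _)
  | more i ih _ => exact hmul (sgn_eq _ _) ih

theorem sigma_sq (Φ F G : ℤ[X][Y]) (I : Set ℝ) (i : ℕ) :
    (sigma Φ F G I i : ℝ) * sigma Φ F G I i = 1 := by
  rcases sigma_eq Φ F G I i with h | h <;> simp [h]

/-- The sign `σ_{I,1}` is the sign of the factor `-τ_0 ρ_1` of `P` in
`R_1 = V 1 * F - τ_0 ρ_1 * P`, where `ρ_1` is `τ_0 ^ (δ - 1)` up to the sign of an antitriangular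
determinant. -/
theorem sigma_one_mul_neg {Φ F G : ℤ[X][Y]} {I : Set ℝ} (hI : I.OrdConnected)
    (hτ : ∀ x ∈ I, aeval x (tau Φ F G 0) ≠ 0) {x : ℝ} (hx : x ∈ I) :
    (sigma Φ F G I 1 : ℝ) * aeval x (tau Φ F G 0 * rho Φ F G 1) < 0 := by
  obtain ⟨n, hn⟩ : ∃ n, n = (tilde Φ F * G).natDegree - F.natDegree := ⟨_, rfl⟩
  have hρ : rho Φ F G 1 = (-1) ^ (n * (n - 1) / 2) * tau Φ F G 0 ^ n := by
    rw [hn]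
    exact coeff_natDegree_subresultant (tilde Φ F * G) F
  have hexp : (n + 1) * (n + 1 + 1) / 2 = n * (n - 1) / 2 + (2 * n + 1) := by
    have h1 := Nat.triangle_succ n
    have h2 := Nat.triangle_succ (n + 1)
    rw [mul_comm]
    simp only [Nat.add_sub_cancel] at h1 h2 ⊢
    rw [h2, h1]
    ring
  have hsq : ((-1 : ℝ) ^ (n * (n - 1) / 2)) * (-1) ^ (n * (n - 1) / 2) = 1 := by
    rw [← mul_pow]; simp
  have hpos := pow_pos (sgn_mul_aeval_pos hI hτ hx) (n + 1)
  have hkey : (sigma Φ F G I 1 : ℝ) * aeval x (tau Φ F G 0 * rho Φ F G 1) =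
      -((sgn I (tau Φ F G 0) : ℝ) * aeval x (tau Φ F G 0)) ^ (n + 1) := by
    rw [hρ, sigma, delta, ← hn, hexp, pow_add, pow_succ _ (2 * n), pow_mul]
    simp only [map_mul, map_pow, map_neg, map_one]
    push_cast
    rw [mul_pow]
    linear_combination (-(sgn I (tau Φ F G 0) : ℝ) ^ (n + 1) *
      aeval x (tau Φ F G 0) ^ (n + 1)) * hsq
  rw [hkey]
  exact neg_neg_of_pos hpos

open Filter Topology

/-! ### Orders of vanishing of Pfaffian functions -/

theorem tilde_monomial (Φ : ℤ[X][Y]) (k : ℕ) (c : ℤ[X]) :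
    tilde Φ (monomial k c) = monomial k (derivative c) + monomial (k - 1) (c * k) * Φ := by
  rw [tilde, derivative_monomial]
  congr 1
  ext1 j
  rw [coeff_derivX, coeff_monomial, coeff_monomial]
  split_ifs <;> simp

theorem tilde_add (Φ F G : ℤ[X][Y]) : tilde Φ (F + G) = tilde Φ F + tilde Φ G := by
  have : derivX (F + G) = derivX F + derivX G := by
    ext1 j
    simp [coeff_derivX]
  rw [tilde, tilde, tilde, this, derivative_add]
  ring

theorem aevalAeval_monomial (x y : ℝ) (k : ℕ) (c : ℤ[X]) :
    aevalAeval x y (monomial k c) = aeval x c * y ^ k := by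
  rw [← C_mul_X_pow_eq_monomial]
  simp only [map_mul, map_pow, aevalAeval_C, aevalAeval_Y]

theorem hasDerivAt_aevalAeval {Φ : ℤ[X][Y]} {φ : ℝ → ℝ} {x : ℝ}
    (hφ : HasDerivAt φ (aevalAeval x (φ x) Φ) x) (H : ℤ[X][Y]) :
    HasDerivAt (fun t => aevalAeval t (φ t) H) (aevalAeval x (φ x) (tilde Φ H)) x := by
  induction H using Polynomial.induction_on' with
  | add p q hp hq =>
    rw [tilde_add]
    simp only [map_add]
    exact hp.add hq
  | monomial k c =>
    rw [tilde_monomial]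
    simp only [map_add, map_mul, aevalAeval_monomial, map_natCast]
    refine ((Polynomial.hasDerivAt_aeval c x).mul (hφ.fun_pow k)).congr_deriv ?_
    ring

/-- Grönwall's inequality in both directions, with a bound that is only locally uniform. -/
theorem eq_zero_of_norm_deriv_le {E : Type*} [NormedAddCommGroup E] [NormedSpace ℝ E] {I : Set ℝ}
    (hI : I.OrdConnected) {u u' : ℝ → E} {K : ℝ → ℝ} (hu : ∀ x ∈ I, HasDerivAt u (u' x) x)
    (hK : ContinuousOn K I) (hb : ∀ x ∈ I, ‖u' x‖ ≤ K x * ‖u x‖) {y : ℝ} (hy : y ∈ I)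
    (hy0 : u y = 0) {x : ℝ} (hx : x ∈ I) : u x = 0 := by
  rcases le_total y x with hyx | hxy
  · have hsub : Set.Icc y x ⊆ I := hI.out hy hx
    obtain ⟨B, hB⟩ := isCompact_Icc.bddAbove_image (hK.mono hsub)
    refine eq_zero_of_abs_deriv_le_mul_abs_self_of_eq_zero_right (f' := u') (K := B)
      (fun t ht => (hu t (hsub ht)).continuousAt.continuousWithinAt)
      (fun t ht => (hu t (hsub (Set.Ico_subset_Icc_self ht))).hasDerivWithinAt) hy0
      (fun t ht => ?_) x (Set.right_mem_Icc.mpr hyx)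
    have ht' := Set.Ico_subset_Icc_self ht
    exact (hb t (hsub ht')).trans
      (mul_le_mul_of_nonneg_right (hB ⟨t, ht', rfl⟩) (norm_nonneg _))
  · have hsub : Set.Icc x y ⊆ I := hI.out hx hy
    obtain ⟨B, hB⟩ := isCompact_Icc.bddAbove_image (hK.mono hsub)
    have hneg {t : ℝ} (ht : t ∈ Set.Icc (-y) (-x)) : -t ∈ Set.Icc x y :=
      ⟨le_neg_of_le_neg ht.2, neg_le_of_neg_le ht.1⟩
    have hd (t : ℝ) (ht : t ∈ Set.Icc (-y) (-x)) :
        HasDerivAt (fun s => u (-s)) (-u' (-t)) t := by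
      simpa [Function.comp_def] using (hu (-t) (hsub (hneg ht))).scomp t (hasDerivAt_neg t)
    have := eq_zero_of_abs_deriv_le_mul_abs_self_of_eq_zero_right (f := fun s => u (-s))
      (f' := fun t => -u' (-t)) (K := B) (a := -y) (b := -x)
      (fun t ht => (hd t ht).continuousAt.continuousWithinAt)
      (fun t ht => (hd t (Set.Ico_subset_Icc_self ht)).hasDerivWithinAt) (by simpa using hy0)
      (fun t ht => ?_) (-x) (Set.right_mem_Icc.mpr (neg_le_neg hxy))
    · simpa using this
    · have ht' := hneg (Set.Ico_subset_Icc_self ht)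
      rw [norm_neg]
      exact (hb _ (hsub ht')).trans
        (mul_le_mul_of_nonneg_right (hB ⟨-t, ht', rfl⟩) (norm_nonneg _))

theorem exists_mem_span_previous {R : Type*} [CommRing R] [IsNoetherianRing R] (D : ℕ → R) :
    ∃ M, D (M + 1) ∈ Ideal.span (Set.range fun i : Fin (M + 1) => D i) := by
  let J : ℕ →o Ideal R :=
    { toFun := fun n => Ideal.span (Set.range fun i : Fin (n + 1) => D i)
      monotone' := fun a b hab => Ideal.span_mono (by
        rintro _ ⟨i, rfl⟩
        exact ⟨⟨i, by omega⟩, rfl⟩) }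
  obtain ⟨M, hM⟩ := monotone_stabilizes_iff_noetherian.mpr ‹IsNoetherianRing R› J
  refine ⟨M, ?_⟩
  change D (M + 1) ∈ J M
  rw [hM (M + 1) (Nat.le_succ M)]
  exact Ideal.subset_span ⟨⟨M + 1, by omega⟩, rfl⟩

variable {Φ F : ℤ[X][Y]} {I : Set ℝ} {φ : ℝ → ℝ}

/-- A Pfaffian function that is not identically zero has no zero of infinite order. By the Hilbert
basis theorem some iterated derivative is a combination of the previous ones, with polynomial
coefficients, so that the vector of these derivatives solves a homogeneous linear differential
equation. -/
theorem exists_iterate_tilde_ne_zero (hI : I.OrdConnected)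
    (hφ : ∀ x ∈ I, HasDerivAt φ (aevalAeval x (φ x) Φ) x)
    (hf : ∃ x ∈ I, aevalAeval x (φ x) F ≠ 0) {y : ℝ} (hy : y ∈ I) :
    ∃ k, aevalAeval y (φ y) ((tilde Φ)^[k] F) ≠ 0 := by
  by_contra! hzero
  obtain ⟨x, hx, hfx⟩ := hf
  obtain ⟨M, hM⟩ := exists_mem_span_previous fun k => (tilde Φ)^[k] F
  obtain ⟨A, hA⟩ := Ideal.mem_span_range_iff_exists_fun.mp hM
  have hderiv (H : ℤ[X][Y]) (t : ℝ) (ht : t ∈ I) := hasDerivAt_aevalAeval (hφ t ht) H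
  have hcont (H : ℤ[X][Y]) : ContinuousOn (fun t => aevalAeval t (φ t) H) I :=
    fun t ht => (hderiv H t ht).continuousAt.continuousWithinAt
  let u : ℝ → Fin (M + 1) → ℝ := fun t i => aevalAeval t (φ t) ((tilde Φ)^[i] F)
  let u' : ℝ → Fin (M + 1) → ℝ := fun t i => aevalAeval t (φ t) ((tilde Φ)^[i + 1] F)
  have hu : u x = 0 := by
    refine eq_zero_of_norm_deriv_le (u' := u')
      (K := fun t => 1 + ∑ i, |aevalAeval t (φ t) (A i)|) hI (fun t ht => ?_) ?_
      (fun t ht => ?_) hy (funext fun i => hzero i) hx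
    · refine hasDerivAt_pi.mpr fun i => ?_
      simp only [u', Function.iterate_succ_apply']
      exact hderiv _ t ht
    · exact continuousOn_const.add (continuousOn_finsetSum _ fun i _ => (hcont (A i)).abs)
    · have hsum0 : 0 ≤ ∑ i, |aevalAeval t (φ t) (A i)| := Finset.sum_nonneg fun i _ => abs_nonneg _
      refine (pi_norm_le_iff_of_nonneg (by positivity)).mpr fun i => ?_
      rcases Nat.lt_or_ge (i + 1 : ℕ) (M + 1) with hi | hi
      · have h1 : ‖u' t i‖ ≤ ‖u t‖ := norm_le_pi_norm (u t) ⟨i + 1, hi⟩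
        refine h1.trans (le_mul_of_one_le_left (norm_nonneg _) ?_)
        linarith
      · have hiM : (i : ℕ) + 1 = M + 1 := by have := i.2; omega
        have h1 : u' t i = ∑ j, aevalAeval t (φ t) (A j) * u t j := by
          simp only [u', hiM, u, ← map_mul, ← map_sum]
          exact congrArg _ hA.symm
        rw [h1]
        calc ‖∑ j, aevalAeval t (φ t) (A j) * u t j‖
            ≤ ∑ j, ‖aevalAeval t (φ t) (A j) * u t j‖ := norm_sum_le _ _
          _ ≤ ∑ j, |aevalAeval t (φ t) (A j)| * ‖u t‖ := by
              refine Finset.sum_le_sum fun j _ => ?_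
              rw [norm_mul, Real.norm_eq_abs (aevalAeval t (φ t) (A j))]
              exact mul_le_mul_of_nonneg_left (norm_le_pi_norm (u t) j) (abs_nonneg _)
          _ = (∑ j, |aevalAeval t (φ t) (A j)|) * ‖u t‖ := by rw [Finset.sum_mul]
          _ ≤ _ := mul_le_mul_of_nonneg_right (by linarith) (norm_nonneg _)
  exact hfx (congrFun hu 0)

/-- A function with a zero of finite order `m` behaves like the leading term of its Taylor
polynomial. -/
theorem tendsto_div_sub_pow {d : ℕ → ℝ → ℝ} {y : ℝ} {m : ℕ}
    (hd : ∀ k, ∀ᶠ x in 𝓝 y, HasDerivAt (d k) (d (k + 1) x) x) (h0 : ∀ k < m, d k y = 0)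
    {j : ℕ} (hj : j ≤ m) :
    Tendsto (fun x => d (m - j) x / (x - y) ^ j) (𝓝[≠] y) (𝓝 (d m y / (j.factorial : ℝ))) := by
  have hc (k : ℕ) : Tendsto (d k) (𝓝[≠] y) (𝓝 (d k y)) :=
    (hd k).self_of_nhds.continuousAt.tendsto.mono_left nhdsWithin_le_nhds
  induction j with
  | zero => simpa using hc m
  | succ j ih =>
    have hne : ∀ᶠ x in 𝓝[≠] y, x - y ≠ 0 :=
      eventually_mem_nhdsWithin.mono fun x hx => sub_ne_zero.mpr hx
    refine HasDerivAt.lhopital_zero_nhdsNE (f' := d (m - j))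
      (g' := fun x => ((j + 1 : ℕ) : ℝ) * (x - y) ^ j) ?_ ?_ ?_ ?_ ?_ ?_
    · have h := hd (m - (j + 1))
      rw [show m - (j + 1) + 1 = m - j by omega] at h
      exact h.filter_mono nhdsWithin_le_nhds
    · exact Eventually.of_forall fun x => by
        simpa using ((hasDerivAt_id x).sub_const y).fun_pow (j + 1)
    · filter_upwards [hne] with x hx
      positivity
    · rw [← h0 (m - (j + 1)) (by omega)]
      exact hc _
    · have : Tendsto (fun x : ℝ => (x - y) ^ (j + 1)) (𝓝 y) (𝓝 ((y - y) ^ (j + 1))) :=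
        ((continuous_id.sub continuous_const).pow _).tendsto y
      simpa using this.mono_left nhdsWithin_le_nhds
    · refine ((ih (by omega)).div_const ((j + 1 : ℕ) : ℝ)).congr' ?_ |>.trans_eq ?_
      · exact Eventually.of_forall fun x => by
          dsimp only
          rw [div_div, mul_comm]
      · rw [div_div, ← Nat.cast_mul, mul_comm, ← Nat.factorial_succ]

/-- At a zero `y` of `f`, the logarithmic derivative is `m / (x - y)` to first order, where `m` is
the multiplicity of the zero. -/
theorem exists_tendsto_div_deriv (hIo : IsOpen I) (hI : I.OrdConnected)
    (hφ : ∀ x ∈ I, HasDerivAt φ (aevalAeval x (φ x) Φ) x)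
    (hf : ∃ x ∈ I, aevalAeval x (φ x) F ≠ 0) {y : ℝ} (hy : y ∈ I)
    (hfy : aevalAeval y (φ y) F = 0) :
    ∃ m : ℝ, 0 < m ∧ (∀ᶠ x in 𝓝[≠] y, aevalAeval x (φ x) (tilde Φ F) ≠ 0) ∧
      Tendsto (fun x => aevalAeval x (φ x) F / (aevalAeval x (φ x) (tilde Φ F) * (x - y)))
        (𝓝[≠] y) (𝓝 m⁻¹) := by
  classical
  have hex := exists_iterate_tilde_ne_zero hI hφ hf hy
  obtain ⟨m, hm⟩ : ∃ m, Nat.find hex = m + 1 :=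
    Nat.exists_eq_succ_of_ne_zero fun h => (Nat.find_eq_zero hex).mp h hfy
  set d : ℕ → ℝ → ℝ := fun k x => aevalAeval x (φ x) ((tilde Φ)^[k] F) with hd_def
  have hd (k : ℕ) : ∀ᶠ x in 𝓝 y, HasDerivAt (d k) (d (k + 1) x) x := by
    filter_upwards [hIo.mem_nhds hy] with x hx
    simp only [hd_def, Function.iterate_succ_apply']
    exact hasDerivAt_aevalAeval (hφ x hx) _
  have h0 (k : ℕ) (hk : k < m + 1) : d k y = 0 := by
    have := Nat.find_min hex (hm ▸ hk)
    simpa [hd_def] using this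
  have hne : d (m + 1) y ≠ 0 := by
    have := Nat.find_spec hex
    rwa [hm] at this
  have hlim0 := tendsto_div_sub_pow hd h0 (le_refl (m + 1))
  have hlim1 := tendsto_div_sub_pow hd h0 (Nat.le_succ m)
  rw [Nat.sub_self] at hlim0
  rw [show m + 1 - m = 1 by omega] at hlim1
  have hfac : (m.factorial : ℝ) ≠ 0 := Nat.cast_ne_zero.mpr m.factorial_ne_zero
  have hpos : (0 : ℝ) < (m + 1 : ℕ) := by positivity
  have hlim1_ne : d (m + 1) y / (m.factorial : ℝ) ≠ 0 := div_ne_zero hne hfac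
  have hsub : ∀ᶠ x in 𝓝[≠] y, x - y ≠ 0 :=
    eventually_mem_nhdsWithin.mono fun x hx => sub_ne_zero.mpr hx
  have hd1 : ∀ᶠ x in 𝓝[≠] y, d 1 x ≠ 0 := by
    filter_upwards [hlim1.eventually_ne hlim1_ne] with x hx h
    exact hx (by rw [h, zero_div])
  refine ⟨(m + 1 : ℕ), hpos, hd1, ?_⟩
  have hlim := hlim0.div hlim1 hlim1_ne
  have hval : d (m + 1) y / ((m + 1).factorial : ℝ) / (d (m + 1) y / (m.factorial : ℝ)) =
      ((m + 1 : ℕ) : ℝ)⁻¹ := by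
    rw [Nat.factorial_succ, Nat.cast_mul]
    field_simp
  rw [hval] at hlim
  refine hlim.congr' ?_
  filter_upwards [hsub, hd1] with x hx hx1
  change d 0 x / (x - y) ^ (m + 1) / (d 1 x / (x - y) ^ m) = d 0 x / (d 1 x * (x - y))
  field_simp
  ring

/-! ### The Sturm conditions -/

section LocalConditions

variable {f f' g k q : ℝ → ℝ} {y m : ℝ}

/-- If `f` has a zero at `y` then `q = (f / f') * (k / g)` has the sign of `(x - y) * g * k` near
`y`. -/
theorem eventually_pos_of_logDeriv (hm : 0 < m) (hne : ∀ᶠ x in 𝓝[≠] y, f' x ≠ 0)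
    (hlim : Tendsto (fun x => f x / (f' x * (x - y))) (𝓝[≠] y) (𝓝 m⁻¹))
    (hcross : ∀ᶠ x in 𝓝 y, q x * (f' x * g x) = k x * f x)
    (hk : ContinuousAt k y) (hky : k y ≠ 0) (hg : ContinuousAt g y) (hgy : g y ≠ 0) :
    ∀ᶠ x in 𝓝[≠] y, 0 < q x * k x * ((x - y) * g y) := by
  have hgg : ∀ᶠ x in 𝓝 y, 0 < g x * g y :=
    (hg.mul continuousAt_const).eventually_const_lt (mul_self_pos.mpr hgy)
  filter_upwards [hne, hlim.eventually_const_lt (inv_pos.mpr hm), eventually_mem_nhdsWithin,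
    hcross.filter_mono nhdsWithin_le_nhds, hgg.filter_mono nhdsWithin_le_nhds,
    (hk.eventually_ne hky).filter_mono nhdsWithin_le_nhds] with x h1 h2 hx h3 h4 h5
  have hx0 : x - y ≠ 0 := sub_ne_zero.mpr hx
  have hsq : 0 < (f' x * (x - y)) ^ 2 := by positivity
  have hff : 0 < f x * (f' x * (x - y)) := by
    have := mul_pos h2 hsq
    rwa [sq, ← mul_assoc, div_mul_cancel₀ _ (by positivity)] at this
  have hk2 : 0 < k x ^ 2 := by positivity
  have hgx : g x ≠ 0 := left_ne_zero_of_mul h4.ne'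
  have hpos : 0 < q x * k x * ((x - y) * g y) * (f' x ^ 2 * g x ^ 2) := by
    calc 0 < k x ^ 2 * (f x * (f' x * (x - y))) * (g x * g y) :=
          mul_pos (mul_pos hk2 hff) h4
      _ = _ := by linear_combination -(k x * f' x * (x - y) * g x * g y) * h3
  exact pos_of_mul_pos_left hpos (by positivity)

/-- Near `y`, the function `q * g = (f / f') * k` is a multiple of `x - y`, up to a convergent
factor. -/
theorem eq_zero_of_logDeriv (hne : ∀ᶠ x in 𝓝[≠] y, f' x ≠ 0)
    (hlim : Tendsto (fun x => f x / (f' x * (x - y))) (𝓝[≠] y) (𝓝 m⁻¹))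
    (hcross : ∀ᶠ x in 𝓝 y, q x * (f' x * g x) = k x * f x)
    (hk : ContinuousAt k y) (hg : ContinuousAt g y) (hgy : g y ≠ 0) (hq : ContinuousAt q y) :
    q y = 0 := by
  have h1 : Tendsto (fun x => q x * g x) (𝓝[≠] y) (𝓝 (q y * g y)) :=
    (hq.mul hg).tendsto.mono_left nhdsWithin_le_nhds
  have h2 : Tendsto (fun x => k x * (x - y) * (f x / (f' x * (x - y)))) (𝓝[≠] y)
      (𝓝 (k y * (y - y) * m⁻¹)) :=
    ((hk.mul (continuousAt_id.sub continuousAt_const)).tendsto.mono_left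
      nhdsWithin_le_nhds).mul hlim
  have h3 : q y * g y = k y * (y - y) * m⁻¹ := by
    refine tendsto_nhds_unique (h1.congr' ?_) h2
    filter_upwards [hne, eventually_mem_nhdsWithin, hcross.filter_mono nhdsWithin_le_nhds]
      with x hx hxy hc
    have hx0 : x - y ≠ 0 := sub_ne_zero.mpr hxy
    field_simp
    linear_combination hc
  rw [sub_self, mul_zero, zero_mul] at h3
  exact (mul_eq_zero.mp h3).resolve_right hgy

/-- If `q` and `g` both vanished at `y`, then `f / f' = q * g / k` would vanish to second order. -/
theorem ne_zero_of_logDeriv (hm : 0 < m) (hne : ∀ᶠ x in 𝓝[≠] y, f' x ≠ 0)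
    (hlim : Tendsto (fun x => f x / (f' x * (x - y))) (𝓝[≠] y) (𝓝 m⁻¹))
    (hcross : ∀ᶠ x in 𝓝 y, q x * (f' x * g x) = k x * f x)
    (hk : ContinuousAt k y) (hky : k y ≠ 0) (hg : ContinuousAt g y) (hq : DifferentiableAt ℝ q y)
    (hqy : q y = 0) : g y ≠ 0 := by
  intro hgy
  have h1 : Tendsto (fun x => k x * (f x / (f' x * (x - y)))) (𝓝[≠] y) (𝓝 (k y * m⁻¹)) :=
    (hk.tendsto.mono_left nhdsWithin_le_nhds).mul hlim
  have h2 : Tendsto (fun x => slope q y x * g x) (𝓝[≠] y) (𝓝 (deriv q y * g y)) :=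
    (hasDerivAt_iff_tendsto_slope.mp hq.hasDerivAt).mul
      (hg.tendsto.mono_left nhdsWithin_le_nhds)
  have h3 : k y * m⁻¹ = deriv q y * g y := by
    refine tendsto_nhds_unique (h1.congr' ?_) h2
    filter_upwards [hne, eventually_mem_nhdsWithin, hcross.filter_mono nhdsWithin_le_nhds]
      with x hx hxy hc
    have hx0 : x - y ≠ 0 := sub_ne_zero.mpr hxy
    rw [slope_def_field, hqy]
    field_simp
    linear_combination -hc
  rw [hgy, mul_zero] at h3
  exact mul_ne_zero hky (inv_ne_zero hm.ne') h3

end LocalConditions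

section

variable {Φ F G : ℤ[X][Y]} {I : Set ℝ} {φ : ℝ → ℝ} {w : ℤ[X]} {Q : ℕ → ℤ[X][Y]} {QP : ℤ[X][Y]}

theorem IsQuotientSeq.sturmFun_eq (h : IsQuotientSeq Φ F G w Q QP) (hF : F ≠ 0) {x : ℝ}
    (hw : aeval x w ≠ 0) (i : ℕ) : sturmFun Φ F G I φ i x =
      sigma Φ F G I i * (aevalAeval x (φ x) (Q i) / aeval x w) := by
  have hw0 : w ≠ 0 := by
    rintro rfl
    simp at hw
  rw [sturmFun, evalRat_eq_div (h.C_mul_Fseq hF hw0 i) hw]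

theorem IsQuotientSeq.sturmFun_eq_zero_iff (h : IsQuotientSeq Φ F G w Q QP) (hF : F ≠ 0) {x : ℝ}
    (hw : aeval x w ≠ 0) (i : ℕ) :
    sturmFun Φ F G I φ i x = 0 ↔ aevalAeval x (φ x) (Q i) = 0 := by
  have hσ : (sigma Φ F G I i : ℝ) ≠ 0 := left_ne_zero_of_mul_eq_one (sigma_sq Φ F G I i)
  rw [h.sturmFun_eq hF hw, mul_eq_zero, div_eq_zero_iff]
  simp only [hσ, hw, false_or, or_false]

/-- The sign condition on consecutive terms, from the remainder identity divided by `R_N`. Two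
consecutive quotients have no common zero since they generate, up to factors without zeros, all the
quotients, including the last one, which has no zero in `I`. -/
theorem IsQuotientSeq.sturmFun_mul_neg (h : IsQuotientSeq Φ F G w Q QP) (hF : F ≠ 0)
    (hI : I.OrdConnected) (hw : ∀ x ∈ I, aeval x w ≠ 0) {i : ℕ}
    (hi : i + 2 ≤ lastIndex Φ F G)
    (hτ : ∀ i ≤ lastIndex Φ F G, ∀ x ∈ I, aeval x (tau Φ F G i) ≠ 0)
    (hρ : ∀ i, 1 ≤ i → i ≤ lastIndex Φ F G + 1 → ∀ x ∈ I, aeval x (rho Φ F G i) ≠ 0)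
    {y : ℝ} (hy : y ∈ I) (h0 : sturmFun Φ F G I φ (i + 1) y = 0) :
    sturmFun Φ F G I φ i y * sturmFun Φ F G I φ (i + 2) y < 0 := by
  rw [h.sturmFun_eq_zero_iff hF (hw y hy)] at h0
  obtain ⟨A, hA⟩ := h.step i hi
  obtain ⟨B, D, hBD⟩ := h.bezout_succ i (by omega)
  have hstep := congrArg (aevalAeval y (φ y)) hA
  have hbez := congrArg (aevalAeval y (φ y)) hBD
  simp only [map_add, map_mul, aevalAeval_C, h0, mul_zero, add_zero] at hstep hbez
  have hτρ (j : ℕ) (hj : j + 1 ≤ lastIndex Φ F G) :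
      aeval y (tau Φ F G j) * aeval y (rho Φ F G (j + 1)) ≠ 0 :=
    mul_ne_zero (hτ j (by omega) y hy) (hρ (j + 1) (by omega) (by omega) y hy)
  have hQi : aevalAeval y (φ y) (Q i) ≠ 0 :=
    right_ne_zero_of_mul (hbez.trans_ne (mul_ne_zero (hτρ i (by omega)) (hw y hy)))
  have hsgn := sgn_mul_aeval_pos hI (x := y)
    (θ := rho Φ F G (i + 2) * tau Φ F G (i + 1) * rho Φ F G (i + 1) * tau Φ F G i)
    (fun x hx => by
      simp only [map_mul]
      exact mul_ne_zero (mul_ne_zero (mul_ne_zero (hρ _ (by omega) (by omega) x hx)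
        (hτ _ (by omega) x hx)) (hρ _ (by omega) (by omega) x hx)) (hτ _ (by omega) x hx)) hy
  rw [h.sturmFun_eq hF (hw y hy), h.sturmFun_eq hF (hw y hy), sigma]
  set s := sgn I (rho Φ F G (i + 2) * tau Φ F G (i + 1) * rho Φ F G (i + 1) * tau Φ F G i)
  simp only [map_mul] at hsgn
  set a := aeval y (tau Φ F G i) * aeval y (rho Φ F G (i + 1)) with ha_def
  set b := aeval y (tau Φ F G (i + 1)) * aeval y (rho Φ F G (i + 2)) with hb_def
  have ha : a ≠ 0 := hτρ i (by omega)
  have hb : b ≠ 0 := hτρ (i + 1) (by omega)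
  have hw' := hw y hy
  have hsq := sigma_sq Φ F G I i
  have hsab : 0 < s * (a * b) := hsgn.trans_eq (by rw [ha_def, hb_def]; ring)
  push_cast
  have hpos : 0 < (s * (a * b)) * (b * aevalAeval y (φ y) (Q i)) ^ 2 :=
    mul_pos hsab (by positivity)
  have hkey : (sigma Φ F G I i * (aevalAeval y (φ y) (Q i) / aeval y w) *
      (s * sigma Φ F G I i * (aevalAeval y (φ y) (Q (i + 2)) / aeval y w))) *
        (aeval y w * (a * b)) ^ 2 =
      -((s * (a * b)) * (b * aevalAeval y (φ y) (Q i)) ^ 2) := by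
    clear_value a b
    trans sigma Φ F G I i ^ 2 * s * (a * b) ^ 2 * aevalAeval y (φ y) (Q i) *
      aevalAeval y (φ y) (Q (i + 2))
    · field_simp
    linear_combination (s * a ^ 2 * b ^ 2 * aevalAeval y (φ y) (Q i) *
      aevalAeval y (φ y) (Q (i + 2))) * hsq +
        (s * a * b ^ 2 * aevalAeval y (φ y) (Q i)) * hstep
  exact neg_of_mul_neg_left (hkey.trans_lt (neg_neg_of_pos hpos)) (sq_nonneg _)

theorem IsQuotientSeq.isSturmSequence (h : IsQuotientSeq Φ F G w Q QP) (hF : F ≠ 0)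
    (hIo : IsOpen I) (hI : I.OrdConnected)
    (hφ : ∀ x ∈ I, HasDerivAt φ (aevalAeval x (φ x) Φ) x)
    (hf : ∃ x ∈ I, aevalAeval x (φ x) F ≠ 0) (hw : ∀ x ∈ I, aeval x w ≠ 0)
    (hτ : ∀ i ≤ lastIndex Φ F G, ∀ x ∈ I, aeval x (tau Φ F G i) ≠ 0)
    (hρ : ∀ i, 1 ≤ i → i ≤ lastIndex Φ F G + 1 → ∀ x ∈ I, aeval x (rho Φ F G i) ≠ 0) :
    IsSturmSequence I (fun x => aevalAeval x (φ x) F) (fun x => aevalAeval x (φ x) G)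
      (lastIndex Φ F G) (sturmFun Φ F G I φ) := by
  have hdiff (H : ℤ[X][Y]) (x : ℝ) (hx : x ∈ I) :
      DifferentiableAt ℝ (fun t => aevalAeval t (φ t) H) x :=
    (hasDerivAt_aevalAeval (hφ x hx) H).differentiableAt
  have hca (H : ℤ[X][Y]) (x : ℝ) (hx : x ∈ I) :
      ContinuousAt (fun t => aevalAeval t (φ t) H) x := (hdiff H x hx).continuousAt
  have hco (H : ℤ[X][Y]) : ContinuousOn (fun x => aevalAeval x (φ x) H) I :=
    fun x hx => (hca H x hx).continuousWithinAt
  have hcross (x : ℝ) : aevalAeval x (φ x) (Q 0) *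
      (aevalAeval x (φ x) (tilde Φ F) * aevalAeval x (φ x) G) =
        aevalAeval x (φ x) QP * aevalAeval x (φ x) F := by
    simpa only [map_mul] using congrArg (aevalAeval x (φ x)) h.cross
  have hcross' (y : ℝ) := Eventually.of_forall (f := 𝓝 y) hcross
  have hfQ {x : ℝ} (hx : x ∈ I) (h0 : aevalAeval x (φ x) (Q 0) = 0) :
      aevalAeval x (φ x) F = 0 := by
    have := congrArg (aevalAeval x (φ x)) (h.mul_eq 0)
    simp only [map_mul, aevalAeval_C, h0, mul_zero] at this
    exact (mul_eq_zero.mp this).resolve_left (hw x hx)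
  have hQP {x : ℝ} (hx : x ∈ I) (h0 : aevalAeval x (φ x) (Q 0) = 0) :
      aevalAeval x (φ x) QP ≠ 0 := by
    obtain ⟨U, V, hUV⟩ := h.bezout
    have := congrArg (aevalAeval x (φ x)) hUV
    simp only [map_add, map_mul, aevalAeval_C, h0, mul_zero, add_zero] at this
    exact right_ne_zero_of_mul (this.trans_ne (hw x hx))
  have hzero {y : ℝ} (hy : y ∈ I) : aevalAeval y (φ y) (Q 0) = 0 ↔
      aevalAeval y (φ y) F = 0 ∧ aevalAeval y (φ y) G ≠ 0 := by
    constructor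
    · intro h0
      obtain ⟨m, hm, hne, hlim⟩ := exists_tendsto_div_deriv hIo hI hφ hf hy (hfQ hy h0)
      exact ⟨hfQ hy h0, ne_zero_of_logDeriv hm hne hlim (hcross' y) (hca QP y hy) (hQP hy h0)
        (hca G y hy) (hdiff (Q 0) y hy) h0⟩
    · rintro ⟨hfy, hgy⟩
      obtain ⟨m, hm, hne, hlim⟩ := exists_tendsto_div_deriv hIo hI hφ hf hy hfy
      exact eq_zero_of_logDeriv hne hlim (hcross' y) (hca QP y hy) (hca G y hy) hgy
        (hca (Q 0) y hy)
  have hlast {y : ℝ} (hy : y ∈ I) : aevalAeval y (φ y) (Q (lastIndex Φ F G)) ≠ 0 := by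
    rw [h.last, aevalAeval_C]
    exact hw y hy
  refine ⟨hco F, hco G, fun i _ => ?_, fun y hy => ?_, fun y hy h0 => ?_, ?_, fun y hy => ?_⟩
  · refine ((continuousOn_const (c := (sigma Φ F G I i : ℝ))).mul ((hco (Q i)).div
      (Polynomial.continuous_aeval w).continuousOn hw)).congr fun x hx => ?_
    exact h.sturmFun_eq hF (hw x hx) i
  · rw [h.sturmFun_eq_zero_iff hF (hw y hy), hzero hy]
  · rw [h.sturmFun_eq_zero_iff hF (hw y hy)] at h0
    have hN : 1 ≤ lastIndex Φ F G :=
      Nat.one_le_iff_ne_zero.mpr fun hN => hlast hy (by rw [hN]; exact h0)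
    obtain ⟨hfy, hgy⟩ := (hzero hy).mp h0
    obtain ⟨m, hm, hne, hlim⟩ := exists_tendsto_div_deriv hIo hI hφ hf hy hfy
    have hsign := eventually_pos_of_logDeriv hm hne hlim (hcross' y) (hca QP y hy) (hQP hy h0)
      (hca G y hy) hgy
    -- at `y`, the first quotient is `-τ_0 ρ_1` times the quotient of `P`
    have hQ1 : 0 < (sigma Φ F G I 1 : ℝ) * aevalAeval y (φ y) (Q 1) * aevalAeval y (φ y) QP := by
      obtain ⟨A, hA⟩ := h.first hN
      have hA' := congrArg (aevalAeval y (φ y)) hA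
      rw [map_sub, map_mul, map_mul, h0, mul_zero, zero_sub, aevalAeval_C] at hA'
      have hσ := sigma_one_mul_neg hI (hτ 0 (Nat.zero_le _)) hy
      have hsq : 0 < aevalAeval y (φ y) QP ^ 2 := by have := hQP hy h0; positivity
      rw [hA']
      linarith [mul_neg_of_neg_of_pos hσ hsq]
    have hQ1' : ∀ᶠ x in 𝓝 y,
        0 < (sigma Φ F G I 1 : ℝ) * aevalAeval x (φ x) (Q 1) * aevalAeval x (φ x) QP :=
      ((continuousAt_const.mul (hca (Q 1) y hy)).mul (hca QP y hy)).eventually_const_lt hQ1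
    obtain ⟨ε, hε, hball⟩ := Metric.eventually_nhds_iff_ball.mp
      ((hIo.eventually_mem hy).and (hQ1'.and (eventually_nhdsWithin_iff.mp hsign)))
    rw [Real.ball_eq_Ioo] at hball
    have hprod {x : ℝ} (hx : x ∈ Set.Ioo (y - ε) (y + ε)) (hxy : x ≠ y) :
        0 < sturmFun Φ F G I φ 0 x * sturmFun Φ F G I φ 1 x *
          ((x - y) * aevalAeval y (φ y) G) := by
      obtain ⟨hxI, h1, h2⟩ := hball x hx
      have hmul := mul_pos h1 (h2 hxy)
      have hwx := hw x hxI
      rw [h.sturmFun_eq hF hwx, h.sturmFun_eq hF hwx, sigma, Int.cast_one, one_mul]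
      have hw2 : 0 < (aeval x w ^ 2)⁻¹ := by positivity
      refine pos_of_mul_pos_left (b := aevalAeval x (φ x) QP ^ 2) ?_ (sq_nonneg _)
      calc 0 < _ := mul_pos hmul hw2
        _ = _ := by ring
    refine ⟨ε, hε, fun x hx => (hball x hx).1, fun x hx => ?_, fun hg => ⟨fun x hx => ?_,
      fun x hx => ?_⟩, fun hg => ⟨fun x hx => ?_, fun x hx => ?_⟩⟩
    · obtain ⟨hxI, h1, -⟩ := hball x hx
      rw [Ne, h.sturmFun_eq_zero_iff hF (hw x hxI)]
      exact right_ne_zero_of_mul (left_ne_zero_of_mul h1.ne')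
    · have := hprod ⟨hx.1, by linarith [hx.2]⟩ hx.2.ne
      exact neg_of_mul_pos_left this (mul_neg_of_neg_of_pos (sub_neg.mpr hx.2) hg).le
    · have := hprod ⟨by linarith [hx.1], hx.2⟩ hx.1.ne'
      exact pos_of_mul_pos_left this (mul_pos (sub_pos.mpr hx.1) hg).le
    · have := hprod ⟨hx.1, by linarith [hx.2]⟩ hx.2.ne
      exact pos_of_mul_pos_left this (mul_pos_of_neg_of_neg (sub_neg.mpr hx.2) hg).le
    · have := hprod ⟨by linarith [hx.1], hx.2⟩ hx.1.ne'
      exact neg_of_mul_pos_left this (mul_neg_of_pos_of_neg (sub_pos.mpr hx.1) hg).le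
  · rintro y hy i hi1 hiN h0
    obtain ⟨j, rfl⟩ := Nat.exists_eq_add_of_le' hi1
    exact h.sturmFun_mul_neg hF hI hw hiN hτ hρ hy h0
  · rw [Ne, h.sturmFun_eq_zero_iff hF (hw y hy)]
    exact hlast hy

end

end PfaffianSturm

theorem mainTheorem6 (Φ F G : ℤ[X][Y])
    (hΦ : 0 < Φ.natDegree) (hF : 0 < F.natDegree) (hG : 0 < G.natDegree)
    (I : Set ℝ) (hIo : IsOpen I) (hIc : I.OrdConnected)
    (φ : ℝ → ℝ) (hφ : ∀ x ∈ I, HasDerivAt φ (aevalAeval x (φ x) Φ) x)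
    (hf : ∃ x ∈ I, aevalAeval x (φ x) F ≠ 0)
    (hτ : ∀ i ≤ PfaffianSturm.lastIndex Φ F G, ∀ x ∈ I,
      aeval x (PfaffianSturm.tau Φ F G i) ≠ 0)
    (hρ : ∀ i, 1 ≤ i → i ≤ PfaffianSturm.lastIndex Φ F G + 1 → ∀ x ∈ I,
      aeval x (PfaffianSturm.rho Φ F G i) ≠ 0) :
    -- the quotients `F_i = R_i / R_N` are exact and are defined at every point of `I`
    (∀ i ≤ PfaffianSturm.lastIndex Φ F G,
      PfaffianSturm.Fseq Φ F G i *
          (PfaffianSturm.Rseq Φ F G (PfaffianSturm.lastIndex Φ F G)).map PfaffianSturm.toRat =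
        (PfaffianSturm.Rseq Φ F G i).map PfaffianSturm.toRat ∧
      ∀ k, ∀ x ∈ I, aeval x ((PfaffianSturm.Fseq Φ F G i).coeff k).denom ≠ 0) ∧
    -- the functions `f_{I,i}` form a Sturm sequence
    PfaffianSturm.IsSturmSequence I (fun x => aevalAeval x (φ x) F)
      (fun x => aevalAeval x (φ x) G) (PfaffianSturm.lastIndex Φ F G)
      (PfaffianSturm.sturmFun Φ F G I φ) := by
  have hF0 : F ≠ 0 := ne_zero_of_natDegree_gt hF
  obtain ⟨x₀, hx₀, -⟩ := id hf
  have hne {θ : ℤ[X]} (hθ : aeval x₀ θ ≠ 0) : θ ≠ 0 := by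
    rintro rfl
    simp at hθ
  have hτN := hτ _ le_rfl
  have hρN := hρ _ (Nat.le_add_left _ _) le_rfl
  obtain ⟨w, Q, QP, h⟩ := PfaffianSturm.exists_isQuotientSeq hF0
    (PfaffianSturm.natDegree_lt_natDegree_tilde_mul hΦ hF hG) (hne (hτN x₀ hx₀))
    (hne (hρN x₀ hx₀))
  have hw (x : ℝ) (hx : x ∈ I) : aeval x w ≠ 0 := by
    rcases h.denom with hw | hw <;> rw [hw]
    · exact hτN x hx
    · rw [map_mul]
      exact mul_ne_zero (hτN x hx) (hρN x hx)
  have hw0 : w ≠ 0 := hne (hw x₀ hx₀)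
  have hCw : (C (PfaffianSturm.toRat w) : Polynomial (RatFunc ℚ)) ≠ 0 :=
    C_ne_zero.mpr ((map_ne_zero_iff _ PfaffianSturm.toRat_injective).mpr hw0)
  refine ⟨fun i _ => ⟨mul_left_cancel₀ hCw ?_, fun k x hx => ?_⟩,
    h.isSturmSequence hF0 hIo hIc hφ hf hw hτ hρ⟩
  · rw [← mul_assoc, h.C_mul_Fseq hF0 hw0, ← Polynomial.map_mul, mul_comm (Q i), ← h.mul_eq,
      Polynomial.map_mul, map_C]
  · exact PfaffianSturm.aeval_denom_ne_zero (w := w) (a := (Q i).coeff k)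
      (by rw [← coeff_C_mul, h.C_mul_Fseq hF0 hw0, coeff_map]) (hw x hx)
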